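/- Let $\Gamma$ be a (discrete) group of type $FP_\infty(\mathbb{Q})$, that is, the trivial $\mathbb{Q}\Gamma$-module $\mathbb{Q}$ has a resolution $0\leftarrow\mathbb{Q}\leftarrow P_0\leftarrow P_1\leftarrow\cdots$ by finitely generated free left $\mathbb{Q}\Gamma$-modules. Let $C^*\Gamma$ be the maximal group $C^*$-algebra, i.e. the completion of $\mathbb{C}\Gamma$ in the norm $\|x\|=\sup_\pi\|\pi(x)\|$, where $\pi$ runs over all unitary representations of $\Gamma$, and regard it as a $\Gamma$-module through left multiplication. For any such resolution $P_\bullet$ with chosen finite bases, the groups $H_n(\Gamma,C^*\Gamma)=H_n(C^*\Gamma\otimes_{\mathbb{Q}\Gamma}P_\bullet)$, where $C^*\Gamma$ is made a right module by $v\gamma=\gamma^{-1}v$, and $H^n(\Gamma,C^*\Gamma)=H^n(\mathrm{Hom}_{\mathbb{Q}\Gamma}(P_\bullet,C^*\Gamma))$ are topological vector spaces: the bases identify $C^*\Gamma\otimes_{\mathbb{Q}\Gamma}P_n$ and $\mathrm{Hom}_{\mathbb{Q}\Gamma}(P_n,C^*\Gamma)$ with finite direct sums of copies of the Banach space $C^*\Gamma$,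 and $H_n$, $H^n$ carry the quotient topology of the subspace topology on the (co)cycles. If $\Gamma$ does not have Kazhdan's property T, then $H_0(\Gamma,C^*\Gamma)$ and $H^1(\Gamma,C^*\Gamma)$ are not Hausdorff. -/

import Mathlib

universe u v

noncomputable section

/-! ### Unitary representations and property T of a discrete group -/

/-- A unitary representation of the discrete group `Γ` on the complex Hilbert space `H`. -/
abbrev UnitaryRep (Γ : Type u) [Group Γ] (H : Type u) [NormedAddCommGroup H]
    [InnerProductSpace ℂ H] [CompleteSpace H] : Type u :=
  Γ →* unitary (H →L[ℂ] H)

/-- Kazhdan's property T of the discrete group `Γ`: there is a Kazhdan pair `(S, ε)`, that is,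
a finite set `S ⊆ Γ` and `ε > 0` such that every unitary representation with an
`(S, ε)`-invariant vector has a nonzero invariant vector. A nonzero vector lies in the
subrepresentation that it generates, whose Hilbert dimension is at most `max |Γ| ℵ₀`, so Hilbert
spaces in the universe of `Γ` are enough. -/
def HasPropertyT (Γ : Type u) [Group Γ] : Prop :=
  ∃ (S : Finset Γ) (ε : ℝ), 0 < ε ∧
    ∀ (H : Type u) [NormedAddCommGroup H] [InnerProductSpace ℂ H] [CompleteSpace H]
      (π : UnitaryRep Γ H),
      (∃ v : H, v ≠ 0 ∧ ∀ s ∈ S, ‖(π s : H →L[ℂ] H) v - v‖ < ε * ‖v‖) →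
        ∃ w : H, w ≠ 0 ∧ ∀ γ : Γ, (π γ : H →L[ℂ] H) w = w

/-! ### The maximal group C*-algebra -/

/-- The extension of a unitary representation to the complex group algebra. -/
def UnitaryRep.toAlgHom {Γ : Type u} [Group Γ] {H : Type u} [NormedAddCommGroup H]
    [InnerProductSpace ℂ H] [CompleteSpace H] (π : UnitaryRep Γ H) :
    MonoidAlgebra ℂ Γ →ₐ[ℂ] (H →L[ℂ] H) :=
  MonoidAlgebra.lift ℂ (H →L[ℂ] H) Γ ((unitary (H →L[ℂ] H)).subtype.comp π)

/-- The norms of the images of `x` under all unitary representations. -/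
def repNorms (Γ : Type u) [Group Γ] (x : MonoidAlgebra ℂ Γ) : Set ℝ :=
  {r | ∃ (H : Type u) (_ : NormedAddCommGroup H) (_ : InnerProductSpace ℂ H)
    (_ : CompleteSpace H) (π : UnitaryRep Γ H), r = ‖π.toAlgHom x‖}

/-- The maximal C*-norm `‖x‖ = sup_π ‖π(x)‖` on the complex group algebra. -/
def maxNorm (Γ : Type u) [Group Γ] (x : MonoidAlgebra ℂ Γ) : ℝ := sSup (repNorms Γ x)

theorem bddAbove_repNorms (Γ : Type u) [Group Γ] (x : MonoidAlgebra ℂ Γ) :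
    BddAbove (repNorms Γ x) := by
  induction x using MonoidAlgebra.induction_on with
  | of γ =>
    refine ⟨1, ?_⟩
    rintro r ⟨H, _, _, _, π, rfl⟩
    have h : π.toAlgHom (MonoidAlgebra.of ℂ Γ γ) = (π γ : H →L[ℂ] H) := by
      simp [UnitaryRep.toAlgHom]
    rw [h]
    rcases subsingleton_or_nontrivial (H →L[ℂ] H) with hs | hn
    · rw [Subsingleton.elim (π γ : H →L[ℂ] H) 0, norm_zero]
      exact zero_le_one
    · exact (CStarRing.norm_coe_unitary (π γ)).le
  | add x y hx hy =>
    obtain ⟨a, ha⟩ := hx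
    obtain ⟨b, hb⟩ := hy
    refine ⟨a + b, ?_⟩
    rintro r ⟨H, i1, i2, i3, π, rfl⟩
    rw [map_add]
    exact (norm_add_le _ _).trans
      (add_le_add (ha ⟨H, i1, i2, i3, π, rfl⟩) (hb ⟨H, i1, i2, i3, π, rfl⟩))
  | smul c x hx =>
    obtain ⟨a, ha⟩ := hx
    refine ⟨‖c‖ * a, ?_⟩
    rintro r ⟨H, i1, i2, i3, π, rfl⟩
    rw [map_smul, norm_smul]
    exact mul_le_mul_of_nonneg_left (ha ⟨H, i1, i2, i3, π, rfl⟩) (norm_nonneg _)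

theorem maxNorm_nonneg (Γ : Type u) [Group Γ] (x : MonoidAlgebra ℂ Γ) : 0 ≤ maxNorm Γ x := by
  apply Real.sSup_nonneg
  rintro r ⟨H, _, _, _, π, rfl⟩
  exact norm_nonneg _

theorem norm_toAlgHom_le_maxNorm {Γ : Type u} [Group Γ] {H : Type u} [NormedAddCommGroup H]
    [InnerProductSpace ℂ H] [CompleteSpace H] (π : UnitaryRep Γ H) (x : MonoidAlgebra ℂ Γ) :
    ‖π.toAlgHom x‖ ≤ maxNorm Γ x :=
  le_csSup (bddAbove_repNorms Γ x) ⟨H, _, _, _, π, rfl⟩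

theorem maxNorm_le {Γ : Type u} [Group Γ] {x : MonoidAlgebra ℂ Γ} {c : ℝ} (hc : 0 ≤ c)
    (h : ∀ (H : Type u) [NormedAddCommGroup H] [InnerProductSpace ℂ H] [CompleteSpace H]
      (π : UnitaryRep Γ H), ‖π.toAlgHom x‖ ≤ c) : maxNorm Γ x ≤ c := by
  apply Real.sSup_le _ hc
  rintro r ⟨H, _, _, _, π, rfl⟩
  exact h H π

/-- The maximal C*-norm as a seminorm of rings. -/
def maxRingSeminorm (Γ : Type u) [Group Γ] : RingSeminorm (MonoidAlgebra ℂ Γ) where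
  toFun := maxNorm Γ
  map_zero' := by
    refine le_antisymm (maxNorm_le le_rfl fun H _ _ _ π => ?_) (maxNorm_nonneg Γ _)
    rw [map_zero, norm_zero]
  add_le' x y := by
    refine maxNorm_le (add_nonneg (maxNorm_nonneg Γ _) (maxNorm_nonneg Γ _))
      fun H _ _ _ π => ?_
    rw [map_add]
    exact (norm_add_le _ _).trans
      (add_le_add (norm_toAlgHom_le_maxNorm π x) (norm_toAlgHom_le_maxNorm π y))
  neg' x := by
    have h : ∀ y : MonoidAlgebra ℂ Γ, maxNorm Γ (-y) ≤ maxNorm Γ y := fun y =>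
      maxNorm_le (maxNorm_nonneg Γ _) fun H _ _ _ π => by
        rw [map_neg, norm_neg]
        exact norm_toAlgHom_le_maxNorm π y
    refine le_antisymm (h x) ?_
    have h2 := h (-x)
    rwa [neg_neg] at h2
  mul_le' x y := by
    refine maxNorm_le (mul_nonneg (maxNorm_nonneg Γ _) (maxNorm_nonneg Γ _))
      fun H _ _ _ π => ?_
    rw [map_mul]
    exact (norm_mul_le _ _).trans (mul_le_mul (norm_toAlgHom_le_maxNorm π x)
      (norm_toAlgHom_le_maxNorm π y) (norm_nonneg _) (maxNorm_nonneg Γ _))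

/-- The complex group algebra as a seminormed ring for the maximal C*-norm. -/
instance groupAlgebraSeminormedRing (Γ : Type u) [Group Γ] :
    SeminormedRing (MonoidAlgebra ℂ Γ) where
  toRing := inferInstance
  __ := (maxRingSeminorm Γ).toAddGroupSeminorm.toSeminormedAddCommGroup
  norm_mul_le := (maxRingSeminorm Γ).mul_le'

theorem groupAlgebra_norm_def {Γ : Type u} [Group Γ] (x : MonoidAlgebra ℂ Γ) :
    ‖x‖ = maxNorm Γ x := rfl

instance groupAlgebraNormedAlgebra (Γ : Type u) [Group Γ] :
    NormedAlgebra ℂ (MonoidAlgebra ℂ Γ) where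
  norm_smul_le c x := by
    refine maxNorm_le (mul_nonneg (norm_nonneg _) (maxNorm_nonneg Γ _)) fun H _ _ _ π => ?_
    rw [map_smul, norm_smul]
    exact mul_le_mul_of_nonneg_left (norm_toAlgHom_le_maxNorm π x) (norm_nonneg _)

/-- The involution `(c γ)* = c̄ γ⁻¹` of the complex group algebra. -/
instance groupAlgebraStar (Γ : Type u) [Group Γ] : Star (MonoidAlgebra ℂ Γ) where
  star x := MonoidAlgebra.ofCoeff
    ((x.coeff.mapDomain (fun γ => γ⁻¹)).mapRange star (star_zero ℂ))

theorem groupAlgebra_star_single {Γ : Type u} [Group Γ] (γ : Γ) (c : ℂ) :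
    star (MonoidAlgebra.single γ c) = MonoidAlgebra.single γ⁻¹ (star c) := by
  change MonoidAlgebra.ofCoeff (((MonoidAlgebra.single γ c).coeff.mapDomain
    (fun γ => γ⁻¹)).mapRange star (star_zero ℂ)) = _
  simp [MonoidAlgebra.coeff_single, Finsupp.mapDomain_single]

theorem groupAlgebra_star_add {Γ : Type u} [Group Γ] (x y : MonoidAlgebra ℂ Γ) :
    star (x + y) = star x + star y := by
  change MonoidAlgebra.ofCoeff _ = MonoidAlgebra.ofCoeff _ + MonoidAlgebra.ofCoeff _
  rw [← MonoidAlgebra.ofCoeff_add]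
  congr 1
  change ((x.coeff + y.coeff).mapDomain _).mapRange star _ = _
  rw [Finsupp.mapDomain_add, Finsupp.mapRange_add star_add]
  rfl

theorem groupAlgebra_star_zero (Γ : Type u) [Group Γ] :
    star (0 : MonoidAlgebra ℂ Γ) = 0 := by
  have h := groupAlgebra_star_add (0 : MonoidAlgebra ℂ Γ) 0
  rwa [add_zero, left_eq_add] at h

instance groupAlgebraStarRing (Γ : Type u) [Group Γ] : StarRing (MonoidAlgebra ℂ Γ) where
  star_involutive x := by
    induction x using MonoidAlgebra.induction_linear with
    | zero => rw [groupAlgebra_star_zero, groupAlgebra_star_zero]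
    | add x y hx hy => rw [groupAlgebra_star_add, groupAlgebra_star_add, hx, hy]
    | single γ c => simp [groupAlgebra_star_single]
  star_mul x y := by
    induction x using MonoidAlgebra.induction_linear with
    | zero => simp [groupAlgebra_star_zero]
    | add x x' hx hx' => rw [add_mul, groupAlgebra_star_add, hx, hx', groupAlgebra_star_add, mul_add]
    | single γ c =>
      induction y using MonoidAlgebra.induction_linear with
      | zero => simp [groupAlgebra_star_zero]
      | add y y' hy hy' =>
        rw [mul_add, groupAlgebra_star_add, hy, hy', groupAlgebra_star_add, add_mul]
      | single δ d =>
        simp only [groupAlgebra_star_single, MonoidAlgebra.single_mul_single, mul_inv_rev, star_mul]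
  star_add := groupAlgebra_star_add

instance groupAlgebraStarModule (Γ : Type u) [Group Γ] : StarModule ℂ (MonoidAlgebra ℂ Γ) where
  star_smul c x := by
    induction x using MonoidAlgebra.induction_linear with
    | zero => simp
    | add x y hx hy => rw [smul_add, star_add, hx, hy, star_add, smul_add]
    | single γ d => simp [groupAlgebra_star_single, MonoidAlgebra.smul_single]

theorem UnitaryRep.toAlgHom_star {Γ : Type u} [Group Γ] {H : Type u} [NormedAddCommGroup H]
    [InnerProductSpace ℂ H] [CompleteSpace H] (π : UnitaryRep Γ H) (x : MonoidAlgebra ℂ Γ) :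
    π.toAlgHom (star x) = star (π.toAlgHom x) := by
  induction x using MonoidAlgebra.induction_linear with
  | zero => simp
  | add x y hx hy => rw [star_add, map_add, hx, hy, map_add, star_add]
  | single γ c =>
    rw [groupAlgebra_star_single]
    simp [UnitaryRep.toAlgHom, MonoidAlgebra.lift_single, ← Unitary.star_eq_inv]

instance groupAlgebraNormedStarGroup (Γ : Type u) [Group Γ] :
    NormedStarGroup (MonoidAlgebra ℂ Γ) where
  norm_star_le x := by
    refine maxNorm_le (maxNorm_nonneg Γ _) fun H _ _ _ π => ?_
    rw [π.toAlgHom_star, norm_star]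
    exact norm_toAlgHom_le_maxNorm π x

theorem groupAlgebra_norm_mul_self_le {Γ : Type u} [Group Γ] (x : MonoidAlgebra ℂ Γ) :
    ‖x‖ * ‖x‖ ≤ ‖star x * x‖ := by
  have h : ‖x‖ ≤ √‖star x * x‖ := by
    refine maxNorm_le (Real.sqrt_nonneg _) fun H _ _ _ π => ?_
    refine Real.le_sqrt_of_sq_le ?_
    rw [sq, ← CStarRing.norm_star_mul_self, ← π.toAlgHom_star, ← map_mul]
    exact norm_toAlgHom_le_maxNorm π _
  calc ‖x‖ * ‖x‖ ≤ √‖star x * x‖ * √‖star x * x‖ :=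
        mul_le_mul h h (norm_nonneg _) (Real.sqrt_nonneg _)
    _ = ‖star x * x‖ := Real.mul_self_sqrt (norm_nonneg _)

/-- The maximal group C*-algebra `C*Γ`: the completion of the complex group algebra in the maximal
C*-norm. -/
abbrev MaxGroupCStar (Γ : Type u) [Group Γ] : Type u :=
  UniformSpace.Completion (MonoidAlgebra ℂ Γ)

/-- The involution of `C*Γ`, extended by continuity from the group algebra. -/
instance maxGroupCStarStar (Γ : Type u) [Group Γ] : Star (MaxGroupCStar Γ) where
  star := UniformSpace.Completion.map star

theorem groupAlgebra_uniformContinuous_star (Γ : Type u) [Group Γ] :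
    UniformContinuous (star : MonoidAlgebra ℂ Γ → MonoidAlgebra ℂ Γ) :=
  (starₗᵢ ℂ : MonoidAlgebra ℂ Γ ≃ₗᵢ⋆[ℂ] MonoidAlgebra ℂ Γ).isometry.uniformContinuous

theorem maxGroupCStar_star_coe {Γ : Type u} [Group Γ] (x : MonoidAlgebra ℂ Γ) :
    star (x : MaxGroupCStar Γ) = ((star x : MonoidAlgebra ℂ Γ) : MaxGroupCStar Γ) :=
  UniformSpace.Completion.map_coe (groupAlgebra_uniformContinuous_star Γ) x

instance maxGroupCStarContinuousStar (Γ : Type u) [Group Γ] : ContinuousStar (MaxGroupCStar Γ) where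
  continuous_star := UniformSpace.Completion.continuous_map

instance maxGroupCStarStarRing (Γ : Type u) [Group Γ] : StarRing (MaxGroupCStar Γ) where
  star_involutive x := by
    induction x using UniformSpace.Completion.induction_on with
    | hp => exact isClosed_eq (by fun_prop) (by fun_prop)
    | ih x => rw [maxGroupCStar_star_coe, maxGroupCStar_star_coe, star_star]
  star_mul x y := by
    induction x, y using UniformSpace.Completion.induction_on₂ with
    | hp => exact isClosed_eq (by fun_prop) (by fun_prop)
    | ih x y =>
      rw [← UniformSpace.Completion.coe_mul, maxGroupCStar_star_coe, maxGroupCStar_star_coe,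
        maxGroupCStar_star_coe, star_mul, UniformSpace.Completion.coe_mul]
  star_add x y := by
    induction x, y using UniformSpace.Completion.induction_on₂ with
    | hp => exact isClosed_eq (by fun_prop) (by fun_prop)
    | ih x y =>
      rw [← UniformSpace.Completion.coe_add, maxGroupCStar_star_coe, maxGroupCStar_star_coe,
        maxGroupCStar_star_coe, star_add, UniformSpace.Completion.coe_add]

instance maxGroupCStarNormedAlgebra (Γ : Type u) [Group Γ] :
    NormedAlgebra ℂ (MaxGroupCStar Γ) where
  norm_smul_le := norm_smul_le

instance maxGroupCStarStarModule (Γ : Type u) [Group Γ] : StarModule ℂ (MaxGroupCStar Γ) where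
  star_smul c x := by
    induction x using UniformSpace.Completion.induction_on with
    | hp =>
      exact isClosed_eq (continuous_star.comp (continuous_const_smul c))
        ((continuous_const_smul (star c)).comp continuous_star)
    | ih x =>
      rw [← UniformSpace.Completion.coe_smul, maxGroupCStar_star_coe, maxGroupCStar_star_coe,
        star_smul, UniformSpace.Completion.coe_smul]

instance maxGroupCStarCStarRing (Γ : Type u) [Group Γ] : CStarRing (MaxGroupCStar Γ) where
  norm_mul_self_le x := by
    induction x using UniformSpace.Completion.induction_on with
    | hp => exact isClosed_le (by fun_prop) (by fun_prop)
    | ih x =>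
      rw [maxGroupCStar_star_coe, ← UniformSpace.Completion.coe_mul,
        UniformSpace.Completion.norm_coe, UniformSpace.Completion.norm_coe]
      exact groupAlgebra_norm_mul_self_le x

/-- `C*Γ` is a unital C*-algebra. -/
instance maxGroupCStarCStarAlgebra (Γ : Type u) [Group Γ] : CStarAlgebra (MaxGroupCStar Γ) where

/-- The canonical homomorphism from `Γ` to the multiplicative monoid of `C*Γ`. -/
def MaxGroupCStar.of (Γ : Type u) [Group Γ] : Γ →* MaxGroupCStar Γ :=
  (UniformSpace.Completion.coeRingHom :
    MonoidAlgebra ℂ Γ →+* MaxGroupCStar Γ).toMonoidHom.comp (MonoidAlgebra.of ℂ Γ)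

/-- The `Γ`-module `C*Γ`, with `Γ` acting by left multiplication. -/
def MaxGroupCStar.leftMul (Γ : Type u) [Group Γ] : Representation ℂ Γ (MaxGroupCStar Γ) :=
  (Algebra.lmul ℂ (MaxGroupCStar Γ)).toRingHom.toMonoidHom.comp (MaxGroupCStar.of Γ)

theorem MaxGroupCStar.leftMul_apply {Γ : Type u} [Group Γ] (γ : Γ) (a : MaxGroupCStar Γ) :
    MaxGroupCStar.leftMul Γ γ a = MaxGroupCStar.of Γ γ * a := rfl

/-! ### Resolutions of finite type -/

/-- A based `ℚΓ`-resolution of the trivial module `ℚ` by finitely generated free left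
`ℚΓ`-modules: an exact sequence `0 ← ℚ ← P 0 ← P 1 ← P 2 ← ⋯` of left `ℚΓ`-modules with a finite
basis of each `P n`. Such a resolution exists if and only if `Γ` is of type `FP_∞(ℚ)`. -/
structure BasedResolution (Γ : Type u) [Group Γ] where
  /-- The modules of the resolution. -/
  P : ℕ → Type v
  [addCommGroup : ∀ n, AddCommGroup (P n)]
  [module : ∀ n, Module (MonoidAlgebra ℚ Γ) (P n)]
  /-- The rank of `P n`. -/
  rank : ℕ → ℕ
  /-- The basis of `P n`. -/
  basis : ∀ n, Module.Basis (Fin (rank n)) (MonoidAlgebra ℚ Γ) (P n)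
  /-- The differential `P (n + 1) → P n`. -/
  d : ∀ n, P (n + 1) →ₗ[MonoidAlgebra ℚ Γ] P n
  /-- The augmentation `P 0 → ℚ`. -/
  aug : P 0 →+ ℚ
  /-- The augmentation is `ℚΓ`-linear, where `ℚΓ` acts on `ℚ` through the sum of the
  coefficients. -/
  aug_smul : ∀ (γ : Γ) (q : ℚ) (x : P 0), aug (MonoidAlgebra.single γ q • x) = q * aug x
  aug_surjective : Function.Surjective aug
  exact_zero : Function.Exact (d 0) aug
  exact_succ : ∀ n, Function.Exact (d (n + 1)) (d n)

attribute [instance] BasedResolution.addCommGroup BasedResolution.module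

namespace BasedResolution

variable {Γ : Type u} [Group Γ]

/-- The entries of the matrix of the differential:
`d n (basis (n + 1) i) = ∑ j, entry n i j • basis n j`. -/
def entry (R : BasedResolution.{u, v} Γ) (n : ℕ) (i : Fin (R.rank (n + 1)))
    (j : Fin (R.rank n)) : MonoidAlgebra ℚ Γ :=
  (R.basis n).repr (R.d n (R.basis (n + 1) i)) j

end BasedResolution

/-! ### Group homology and cohomology as topological vector spaces -/

section Complexes

variable {Γ : Type u} [Group Γ] {V : Type*} [AddCommGroup V] [Module ℂ V]

/-- The action of `a ∈ ℚΓ` on the left `Γ`-module `V`: `v ↦ ∑ a_γ γ v`. -/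
def leftAct (ρ : Representation ℂ Γ V) (a : MonoidAlgebra ℚ Γ) : V →ₗ[ℂ] V :=
  a.coeff.sum fun γ q => (q : ℂ) • ρ γ

/-- The right action of `a ∈ ℚΓ` on `V`, which is obtained from the left action through the
involution `γ ↦ γ⁻¹` of the group algebra: `v ↦ v a = ∑ a_γ γ⁻¹ v`. -/
def rightAct (ρ : Representation ℂ Γ V) (a : MonoidAlgebra ℚ Γ) : V →ₗ[ℂ] V :=
  a.coeff.sum fun γ q => (q : ℂ) • ρ γ⁻¹

namespace BasedResolution

variable (R : BasedResolution.{u, v} Γ) (ρ : Representation ℂ Γ V)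

/-- The boundary map `id ⊗ d : V ⊗ P (n + 1) → V ⊗ P n` (tensor products over `ℚΓ`), where
`V ⊗ P n` is identified with a finite sum of copies of `V` by `x ↦ ∑ i, x i ⊗ basis n i`. -/
def boundary (n : ℕ) : (Fin (R.rank (n + 1)) → V) →ₗ[ℂ] (Fin (R.rank n) → V) :=
  LinearMap.pi fun j => ∑ i, rightAct ρ (R.entry n i j) ∘ₗ LinearMap.proj i

/-- The coboundary map `f ↦ f ∘ d : Hom(P n, V) → Hom(P (n + 1), V)` (homomorphisms of
`ℚΓ`-modules), where `Hom(P n, V)` is identified with a finite sum of copies of `V` by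
`f ↦ (f (basis n i))_i`. -/
def coboundary (n : ℕ) : (Fin (R.rank n) → V) →ₗ[ℂ] (Fin (R.rank (n + 1)) → V) :=
  LinearMap.pi fun i => ∑ j, leftAct ρ (R.entry n i j) ∘ₗ LinearMap.proj j

/-- The `n`-cycles of the complex `V ⊗ P`. -/
def cycles : (n : ℕ) → Submodule ℂ (Fin (R.rank n) → V)
  | 0 => ⊤
  | n + 1 => LinearMap.ker (R.boundary ρ n)

/-- The `n`-boundaries of the complex `V ⊗ P`. -/
def boundaries (n : ℕ) : Submodule ℂ (Fin (R.rank n) → V) :=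
  LinearMap.range (R.boundary ρ n)

/-- The `n`-cocycles of the complex `Hom(P, V)`. -/
def cocycles (n : ℕ) : Submodule ℂ (Fin (R.rank n) → V) :=
  LinearMap.ker (R.coboundary ρ n)

/-- The `n`-coboundaries of the complex `Hom(P, V)`. -/
def coboundaries : (n : ℕ) → Submodule ℂ (Fin (R.rank n) → V)
  | 0 => ⊥
  | n + 1 => LinearMap.range (R.coboundary ρ n)

/-- The group homology `H_n(Γ, V)`. For a topological vector space `V` it carries the quotient
of the subspace topology on the cycles. -/
abbrev Homology (n : ℕ) : Type _ :=
  R.cycles ρ n ⧸ (R.boundaries ρ n).submoduleOf (R.cycles ρ n)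

/-- The group cohomology `H^n(Γ, V)`. For a topological vector space `V` it carries the quotient
of the subspace topology on the cocycles. -/
abbrev Cohomology (n : ℕ) : Type _ :=
  R.cocycles ρ n ⧸ (R.coboundaries ρ n).submoduleOf (R.cocycles ρ n)

end BasedResolution

end Complexes

end

/-! The proof is by contraposition: a Hausdorff quotient makes the boundaries or coboundaries
closed, the open mapping theorem turns closed range into a norm estimate, and this estimate gives a
Kazhdan pair.

Let `A = C*Γ`, let `S ⊆ Γ` be finite, and put `d_s = s - 1 ∈ A`, `a = ∑ d_s* d_s` and `e_δ = a (a +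
δ)⁻¹`. The common target is `HasBoundedSupportFactorization`: `e_δ = ∑ x_s d_s` with `‖x_s‖ ≤ C` for
a `C` independent of `δ`. In a representation without nonzero invariant vectors, `a` is injective
and self-adjoint, so its range is dense. On this range `e_δ` tends strongly to the identity, hence
`‖v‖ ≤ C ∑ ‖s v - v‖` for every `v`, which excludes almost invariant vectors.

For `H_0`, the right ideal `∑ d_s* A` is closed, and `e_δ` lies in it. For `H^1`, any `b` can be
changed by an element annihilated by all `d_s` so that its norm is controlled by `∑ ‖d_s b‖`. This
is applied to `b = (a + δ)^(-1/2)`, for which `‖d_s b‖ ≤ 1`.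

An arbitrary resolution is compared with the presentation of `ℚ` by the elements `s - 1` through `x
↦ x p`, where `p ∈ P 0` has augmentation 1, and through `augLift : P 0 → ℚΓ`. The comparison also
yields a finite `S` that generates the augmentation ideal (`exists_augLift_mem`). -/

theorem ContinuousLinearMap.exists_preimage_norm_le_of_isClosed_range {𝕜 E F : Type*}
    [NontriviallyNormedField 𝕜] [NormedAddCommGroup E] [NormedSpace 𝕜 E] [CompleteSpace E]
    [NormedAddCommGroup F] [NormedSpace 𝕜 F] [CompleteSpace F] (T : E →L[𝕜] F)
    (hT : IsClosed (Set.range T)) :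
    ∃ C > 0, ∀ x, ∃ y, T y = T x ∧ ‖y‖ ≤ C * ‖T x‖ := by
  have hc : IsClosed (T.range : Set F) := by
    rwa [LinearMap.coe_range]
  have : CompleteSpace T.range := hc.completeSpace_coe
  obtain ⟨C, hC, h⟩ := T.rangeRestrict.exists_preimage_norm_le T.toLinearMap.surjective_rangeRestrict
  refine ⟨C, hC, fun x => ?_⟩
  obtain ⟨y, hy, hn⟩ := h (T.rangeRestrict x)
  exact ⟨y, congrArg Subtype.val hy, hn⟩

/-! ### Regularized supports and bounded factorizations in C*-algebras -/

section CStar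

variable {A : Type*} [CStarAlgebra A] {ι : Type*} [Fintype ι]

theorem isSelfAdjoint_sum_star_mul_self (d : ι → A) : IsSelfAdjoint (∑ s, star (d s) * d s) :=
  isSelfAdjoint_sum _ fun s _ => IsSelfAdjoint.star_mul_self (d s)

theorem spectrum_sum_star_mul_self_nonneg (d : ι → A) :
    ∀ t ∈ spectrum ℝ (∑ s, star (d s) * d s), 0 ≤ t := by
  let _ := CStarAlgebra.spectralOrder A
  have _ := CStarAlgebra.spectralOrderedRing A
  intro t ht
  exact spectrum_nonneg_of_nonneg (Finset.sum_nonneg fun s _ => star_mul_self_nonneg (d s)) ht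

/-- The regularized support `a (a + δ)⁻¹` of a positive element `a`. -/
noncomputable def regularizedSupport (a : A) (δ : ℝ) : A := cfc (fun t : ℝ => t / (t + δ)) a

/-- The regularized inverse square root `(a + δ)^(-1/2)` of a positive element `a`. -/
noncomputable def regularizedInvSqrt (a : A) (δ : ℝ) : A := cfc (fun t : ℝ => (√(t + δ))⁻¹) a

theorem continuousOn_inv_add {a : A} (hpos : ∀ t ∈ spectrum ℝ a, 0 ≤ t) {δ : ℝ} (hδ : 0 < δ) :
    ContinuousOn (fun t : ℝ => (t + δ)⁻¹) (spectrum ℝ a) :=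
  (continuousOn_id.add continuousOn_const).inv₀ fun t ht =>
    (add_pos_of_nonneg_of_pos (hpos t ht) hδ).ne'

theorem continuousOn_inv_sqrt_add {a : A} (hpos : ∀ t ∈ spectrum ℝ a, 0 ≤ t) {δ : ℝ}
    (hδ : 0 < δ) : ContinuousOn (fun t : ℝ => (√(t + δ))⁻¹) (spectrum ℝ a) :=
  (continuousOn_id.add continuousOn_const).sqrt.inv₀ fun t ht =>
    (Real.sqrt_pos.2 (add_pos_of_nonneg_of_pos (hpos t ht) hδ)).ne'

theorem continuousOn_div_add {a : A} (hpos : ∀ t ∈ spectrum ℝ a, 0 ≤ t) {δ : ℝ} (hδ : 0 < δ) :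
    ContinuousOn (fun t : ℝ => t / (t + δ)) (spectrum ℝ a) := by
  simp only [div_eq_mul_inv]
  exact continuousOn_id.mul (continuousOn_inv_add hpos hδ)

theorem norm_regularizedSupport_le {a : A} (hpos : ∀ t ∈ spectrum ℝ a, 0 ≤ t) {δ : ℝ}
    (hδ : 0 < δ) : ‖regularizedSupport a δ‖ ≤ 1 := by
  refine norm_cfc_le zero_le_one fun t ht => ?_
  have := hpos t ht
  rw [Real.norm_of_nonneg (by positivity), div_le_one (by positivity)]
  linarith

theorem regularizedSupport_eq_mul {a : A} (ha : IsSelfAdjoint a)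
    (hpos : ∀ t ∈ spectrum ℝ a, 0 ≤ t) {δ : ℝ} (hδ : 0 < δ) :
    regularizedSupport a δ = a * cfc (fun t : ℝ => (t + δ)⁻¹) a := by
  have h := cfc_mul (fun t : ℝ => t) (fun t : ℝ => (t + δ)⁻¹) a continuousOn_id
    (continuousOn_inv_add hpos hδ)
  rw [cfc_id' ℝ a ha] at h
  rw [← h]
  simp only [regularizedSupport, div_eq_mul_inv]

/-- At a spectral value `t ≥ 0` the defect is `δ · t / (t + δ) ≤ δ`, so the regularized supports act
as approximate units on `a`. -/
theorem norm_regularizedSupport_mul_sub_le {a : A} (ha : IsSelfAdjoint a)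
    (hpos : ∀ t ∈ spectrum ℝ a, 0 ≤ t) {δ : ℝ} (hδ : 0 < δ) :
    ‖regularizedSupport a δ * a - a‖ ≤ δ := by
  have h : regularizedSupport a δ * a - a = cfc (fun t : ℝ => t / (t + δ) * t - t) a := by
    rw [cfc_sub (fun t : ℝ => t / (t + δ) * t) (fun t => t) a
        ((continuousOn_div_add hpos hδ).mul continuousOn_id) continuousOn_id,
      cfc_mul (fun t : ℝ => t / (t + δ)) (fun t => t) a (continuousOn_div_add hpos hδ)
        continuousOn_id, cfc_id' ℝ a ha]
    rfl
  rw [h]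
  refine norm_cfc_le hδ.le fun t ht => ?_
  have := hpos t ht
  have h2 : t / (t + δ) * t - t = -(δ * (t / (t + δ))) := by field_simp; ring
  rw [h2, norm_neg, Real.norm_of_nonneg (by positivity)]
  refine mul_le_of_le_one_right hδ.le ?_
  rw [div_le_one (by positivity)]
  linarith

theorem isSelfAdjoint_regularizedInvSqrt (a : A) (δ : ℝ) :
    IsSelfAdjoint (regularizedInvSqrt a δ) := cfc_predicate _ a

theorem regularizedSupport_eq_conj {a : A} (ha : IsSelfAdjoint a)
    (hpos : ∀ t ∈ spectrum ℝ a, 0 ≤ t) {δ : ℝ} (hδ : 0 < δ) :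
    regularizedSupport a δ = regularizedInvSqrt a δ * a * regularizedInvSqrt a δ := by
  have hc := continuousOn_inv_sqrt_add hpos hδ
  have h : regularizedInvSqrt a δ * a * regularizedInvSqrt a δ =
      cfc (fun t : ℝ => (√(t + δ))⁻¹ * t * (√(t + δ))⁻¹) a := by
    rw [cfc_mul (fun t : ℝ => (√(t + δ))⁻¹ * t) (fun t => (√(t + δ))⁻¹) a
        (hc.mul continuousOn_id) hc,
      cfc_mul (fun t : ℝ => (√(t + δ))⁻¹) (fun t => t) a hc continuousOn_id, cfc_id' ℝ a ha]
    rfl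
  rw [h]
  refine cfc_congr fun t ht => ?_
  have := hpos t ht
  have h2 : √(t + δ) * √(t + δ) = t + δ := Real.mul_self_sqrt (by positivity)
  have h3 : 0 < √(t + δ) := Real.sqrt_pos.2 (by positivity)
  change t / (t + δ) = _
  conv_lhs => rw [← h2]
  field_simp

/-- With `h = (a + δ)^(-1/2)`, conjugating `d_s* d_s ≤ a` by `h` gives `(d_s h)* (d_s h) ≤ h a h =
e_δ`, and `‖e_δ‖ ≤ 1`. -/
theorem norm_mul_regularizedInvSqrt_le (d : ι → A) {δ : ℝ} (hδ : 0 < δ) (s : ι) :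
    ‖d s * regularizedInvSqrt (∑ s, star (d s) * d s) δ‖ ≤ 1 := by
  let _ := CStarAlgebra.spectralOrder A
  have _ := CStarAlgebra.spectralOrderedRing A
  set a := ∑ s, star (d s) * d s with ha
  set h := regularizedInvSqrt a δ with hh
  have hsa : IsSelfAdjoint h := isSelfAdjoint_regularizedInvSqrt a δ
  have hle : star (d s) * d s ≤ a :=
    Finset.single_le_sum (f := fun s => star (d s) * d s)
      (fun i _ => star_mul_self_nonneg (d i)) (Finset.mem_univ s)
  have h1 : star (d s * h) * (d s * h) ≤ h * a * h := by
    have := star_left_conjugate_le_conjugate hle h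
    rw [hsa.star_eq] at this
    simpa [star_mul, hsa.star_eq, mul_assoc] using this
  have h2 : ‖star (d s * h) * (d s * h)‖ ≤ 1 := by
    refine (CStarAlgebra.norm_le_norm_of_nonneg_of_le (star_mul_self_nonneg _) h1).trans ?_
    rw [hh, ← regularizedSupport_eq_conj (isSelfAdjoint_sum_star_mul_self d)
      (spectrum_sum_star_mul_self_nonneg d) hδ]
    exact norm_regularizedSupport_le (spectrum_sum_star_mul_self_nonneg d) hδ
  rw [CStarRing.norm_star_mul_self] at h2
  nlinarith [norm_nonneg (d s * h)]

/-- The regularized supports of `∑ s, (d s)* (d s)` are combinations of the `d s` with uniformly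
bounded coefficients. -/
def HasBoundedSupportFactorization (d : ι → A) : Prop :=
  ∃ C : ℝ, ∀ δ > 0, ∃ x : ι → A, (∀ s, ‖x s‖ ≤ C) ∧
    ∑ s, x s * d s = regularizedSupport (∑ s, star (d s) * d s) δ

/-- The obvious preimage `d_s (a + δ)⁻¹` of `e_δ` may blow up as `δ → 0`. The open mapping theorem
replaces it by a preimage of norm at most `C ‖e_δ‖ ≤ C`. Taking adjoints of the self-adjoint `e_δ`
moves the coefficients to the left. -/
theorem hasBoundedSupportFactorization_of_isClosed_range (d : ι → A)
    (h : IsClosed (Set.range fun x : ι → A => ∑ s, star (d s) * x s)) :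
    HasBoundedSupportFactorization d := by
  let T : (ι → A) →L[ℂ] A :=
    ∑ s, (ContinuousLinearMap.mul ℂ A (star (d s))) ∘L ContinuousLinearMap.proj s
  have hT : ∀ x, T x = ∑ s, star (d s) * x s := fun x => by simp [T]
  obtain ⟨C, hC, hpre⟩ := T.exists_preimage_norm_le_of_isClosed_range
    (by rwa [show (T : (ι → A) → A) = _ from funext hT])
  refine ⟨C, fun δ hδ => ?_⟩
  set a := ∑ s, star (d s) * d s with ha
  have hsa : IsSelfAdjoint a := isSelfAdjoint_sum_star_mul_self d
  have hpos := spectrum_sum_star_mul_self_nonneg d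
  obtain ⟨y, hy, hn⟩ := hpre fun s => d s * cfc (fun t : ℝ => (t + δ)⁻¹) a
  have he : T (fun s => d s * cfc (fun t : ℝ => (t + δ)⁻¹) a) = regularizedSupport a δ := by
    rw [regularizedSupport_eq_mul hsa hpos hδ, hT]
    simp only [ha, Finset.sum_mul, mul_assoc]
  rw [he] at hy hn
  have hy1 : ‖y‖ ≤ C := hn.trans
    (mul_le_of_le_one_right hC.le (norm_regularizedSupport_le hpos hδ))
  refine ⟨fun s => star (y s), fun s => ?_, ?_⟩
  · rw [norm_star]
    exact (norm_le_pi_norm y s).trans hy1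
  · have hes : IsSelfAdjoint (regularizedSupport a δ) := cfc_predicate _ a
    rw [← hes.star_eq, ← hy, hT, star_sum]
    simp

/-- For `b = (a + δ)^(-1/2)` the corrected `y` is bounded uniformly in `δ` because `‖d_s b‖ ≤ 1`.
Since `a y = a b`, one factor of `e_δ = b a b` can be replaced by `y*`. -/
theorem hasBoundedSupportFactorization_of_bounded_correction (d : ι → A) {C : ℝ} (hC : 0 ≤ C)
    (h : ∀ b, ∃ y, (∀ s, d s * y = d s * b) ∧ ‖y‖ ≤ C * ∑ s, ‖d s * b‖) :
    HasBoundedSupportFactorization d := by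
  refine ⟨C * Fintype.card ι, fun δ hδ => ?_⟩
  set a := ∑ s, star (d s) * d s with ha
  have hsa : IsSelfAdjoint a := isSelfAdjoint_sum_star_mul_self d
  have hpos := spectrum_sum_star_mul_self_nonneg d
  set b := regularizedInvSqrt a δ with hb
  have hbsa : IsSelfAdjoint b := isSelfAdjoint_regularizedInvSqrt a δ
  have hdb : ∀ s, ‖d s * b‖ ≤ 1 := fun s => norm_mul_regularizedInvSqrt_le d hδ s
  obtain ⟨y, hy, hn⟩ := h b
  have hy1 : ‖y‖ ≤ C * Fintype.card ι := by
    refine hn.trans (mul_le_mul_of_nonneg_left ?_ hC)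
    calc ∑ s, ‖d s * b‖ ≤ ∑ _s : ι, (1 : ℝ) := Finset.sum_le_sum fun s _ => hdb s
      _ = Fintype.card ι := by simp
  have hay : a * y = a * b := by
    simp only [ha, Finset.sum_mul, mul_assoc, hy]
  have hya : star y * a = b * a := by
    have := congrArg star hay
    rwa [star_mul, star_mul, hsa.star_eq, hbsa.star_eq] at this
  have hba : b * a = a * b := by
    have h1 := cfc_commute_cfc (fun t : ℝ => (√(t + δ))⁻¹) (fun t : ℝ => t) a
    rw [cfc_id' ℝ a hsa] at h1
    exact h1.eq
  -- These coefficients sum to `y* b a = y* a b = b a b = e_δ`.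
  refine ⟨fun s => star y * star (d s * b), fun s => ?_, ?_⟩
  · refine (norm_mul_le _ _).trans ?_
    rw [norm_star, norm_star]
    exact (mul_le_of_le_one_right (norm_nonneg _) (hdb s)).trans hy1
  · have h1 : ∑ s, star y * star (d s * b) * d s = star y * (b * a) := by
      simp only [star_mul, hbsa.star_eq, ha, Finset.mul_sum, mul_assoc]
    rw [h1, hba, ← mul_assoc, hya, regularizedSupport_eq_conj hsa hpos hδ]

/-- The factorization bounds `‖e_δ u‖` uniformly in `δ`. For `u = a z` the limit `δ → 0` bounds
`‖u‖` itself, and the kernel condition makes such `u` dense. -/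
theorem HasBoundedSupportFactorization.exists_norm_le {d : ι → A}
    (hd : HasBoundedSupportFactorization d) :
    ∃ C : ℝ, ∀ (H : Type u) [NormedAddCommGroup H] [InnerProductSpace ℂ H] [CompleteSpace H]
      (φ : A →⋆ₐ[ℂ] (H →L[ℂ] H)), (∀ w, (∀ s, φ (d s) w = 0) → w = 0) →
        ∀ v, ‖v‖ ≤ C * ∑ s, ‖φ (d s) v‖ := by
  obtain ⟨C, hC⟩ := hd
  refine ⟨C, fun H _ _ _ φ hker v => ?_⟩
  set a := ∑ s, star (d s) * d s with ha
  have hsa : IsSelfAdjoint a := isSelfAdjoint_sum_star_mul_self d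
  have hpos := spectrum_sum_star_mul_self_nonneg d
  have hφ : ∀ x : A, ‖φ x‖ ≤ ‖x‖ := fun x => NonUnitalStarAlgHom.norm_apply_le φ x
  have hsupp : ∀ δ > 0, ∀ u, ‖φ (regularizedSupport a δ) u‖ ≤ C * ∑ s, ‖φ (d s) u‖ := by
    intro δ hδ u
    obtain ⟨x, hx, hsum⟩ := hC δ hδ
    rw [← hsum, map_sum, sum_apply, Finset.mul_sum]
    refine (norm_sum_le _ _).trans (Finset.sum_le_sum fun s _ => ?_)
    rw [map_mul, mul_apply_eq_comp]
    refine (ContinuousLinearMap.le_opNorm _ _).trans ?_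
    exact mul_le_mul_of_nonneg_right ((hφ _).trans (hx s)) (norm_nonneg _)
  have hrange : ∀ z, ‖φ a z‖ ≤ C * ∑ s, ‖φ (d s) (φ a z)‖ := by
    intro z
    refine le_of_forall_pos_le_add fun ε hε => ?_
    set δ := ε / (‖z‖ + 1) with hδd
    have hδ : 0 < δ := by positivity
    have h1 : ‖φ (regularizedSupport a δ) (φ a z) - φ a z‖ ≤ ε := by
      have h2 : φ (regularizedSupport a δ) (φ a z) - φ a z =
          φ (regularizedSupport a δ * a - a) z := by
        simp [map_sub, map_mul]
      rw [h2]
      refine (ContinuousLinearMap.le_opNorm _ _).trans ?_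
      calc ‖φ (regularizedSupport a δ * a - a)‖ * ‖z‖ ≤ δ * (‖z‖ + 1) :=
            mul_le_mul ((hφ _).trans (norm_regularizedSupport_mul_sub_le hsa hpos hδ))
              (by linarith) (norm_nonneg _) hδ.le
        _ = ε := by rw [hδd]; field_simp
    have h3 := hsupp δ hδ (φ a z)
    have h4 := norm_sub_norm_le (φ a z) (φ (regularizedSupport a δ) (φ a z))
    rw [norm_sub_rev] at h4
    linarith
  -- Uses `⟨w, a w⟩ = ∑ ‖d_s w‖²`: a vector killed by `a` is killed by every `d_s`.
  have hinj : (φ a).ker = ⊥ := by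
    refine (Submodule.eq_bot_iff _).2 fun w hw => hker w fun s => ?_
    have hw0 : φ a w = 0 := hw
    have h1 : ∑ s, ‖φ (d s) w‖ ^ 2 = 0 := by
      have h2 : (∑ s, ((‖φ (d s) w‖ ^ 2 : ℝ) : ℂ)) = 0 := by
        calc (∑ s, ((‖φ (d s) w‖ ^ 2 : ℝ) : ℂ)) = inner ℂ w (φ a w) := by
              rw [ha, map_sum, sum_apply, inner_sum]
              refine Finset.sum_congr rfl fun s _ => ?_
              rw [map_mul, map_star, mul_apply_eq_comp,
                ContinuousLinearMap.star_eq_adjoint, ContinuousLinearMap.adjoint_inner_right,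
                inner_self_eq_norm_sq_to_K]
              simp
          _ = 0 := by rw [hw0, inner_zero_right]
      exact_mod_cast h2
    have h3 := (Finset.sum_eq_zero_iff_of_nonneg fun s _ => sq_nonneg ‖φ (d s) w‖).1 h1 s
      (Finset.mem_univ s)
    simpa using h3
  have hdense : DenseRange (φ a) := by
    have h1 : (φ a).rangeᗮ = ⊥ := by
      rw [ContinuousLinearMap.orthogonal_range, ← ContinuousLinearMap.star_eq_adjoint, ← map_star,
        hsa.star_eq, hinj]
    have h2 := Submodule.topologicalClosure_eq_top_iff.2 h1
    have h3 := Submodule.dense_iff_topologicalClosure_eq_top.2 h2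
    rwa [LinearMap.coe_range] at h3
  refine hdense.induction_on (p := fun v => ‖v‖ ≤ C * ∑ s, ‖φ (d s) v‖) v ?_ hrange
  exact isClosed_le (by fun_prop) (by fun_prop)

end CStar

/-! ### Extending representations to `C*Γ`; the image of `ℚΓ` -/

section Group

variable {Γ : Type u} [Group Γ]

theorem UnitaryRep.continuous_toAlgHom {H : Type u} [NormedAddCommGroup H]
    [InnerProductSpace ℂ H] [CompleteSpace H] (π : UnitaryRep Γ H) :
    Continuous π.toAlgHom :=
  AddMonoidHomClass.continuous_of_bound π.toAlgHom 1 fun x => by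
    rw [one_mul]
    exact norm_toAlgHom_le_maxNorm π x

/-- The extension of a unitary representation to the maximal group C*-algebra. -/
noncomputable def UnitaryRep.toStarAlgHom {H : Type u} [NormedAddCommGroup H]
    [InnerProductSpace ℂ H] [CompleteSpace H] (π : UnitaryRep Γ H) :
    MaxGroupCStar Γ →⋆ₐ[ℂ] (H →L[ℂ] H) where
  toRingHom := UniformSpace.Completion.extensionHom
    (π.toAlgHom : MonoidAlgebra ℂ Γ →+* (H →L[ℂ] H)) π.continuous_toAlgHom
  commutes' c := by
    change UniformSpace.Completion.extensionHom _ π.continuous_toAlgHom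
      ((algebraMap ℂ (MonoidAlgebra ℂ Γ) c : MonoidAlgebra ℂ Γ) : MaxGroupCStar Γ) = _
    rw [UniformSpace.Completion.extensionHom_coe]
    exact π.toAlgHom.commutes c
  map_star' x := by
    change UniformSpace.Completion.extensionHom _ π.continuous_toAlgHom (star x) =
      star (UniformSpace.Completion.extensionHom _ π.continuous_toAlgHom x)
    have hc : Continuous (UniformSpace.Completion.extensionHom
        (π.toAlgHom : MonoidAlgebra ℂ Γ →+* (H →L[ℂ] H)) π.continuous_toAlgHom) :=
      UniformSpace.Completion.continuous_extension
    induction x using UniformSpace.Completion.induction_on with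
    | hp => exact isClosed_eq (hc.comp continuous_star) (continuous_star.comp hc)
    | ih x =>
      rw [maxGroupCStar_star_coe, UniformSpace.Completion.extensionHom_coe,
        UniformSpace.Completion.extensionHom_coe]
      exact π.toAlgHom_star x

theorem UnitaryRep.toStarAlgHom_of {H : Type u} [NormedAddCommGroup H]
    [InnerProductSpace ℂ H] [CompleteSpace H] (π : UnitaryRep Γ H) (γ : Γ) :
    π.toStarAlgHom (MaxGroupCStar.of Γ γ) = (π γ : H →L[ℂ] H) := by
  change UniformSpace.Completion.extensionHom _ π.continuous_toAlgHom
      ((MonoidAlgebra.of ℂ Γ γ : MonoidAlgebra ℂ Γ) : MaxGroupCStar Γ) = _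
  rw [UniformSpace.Completion.extensionHom_coe]
  simp [UnitaryRep.toAlgHom]

/-- The homomorphism from the rational group algebra to a complex algebra that extends a
homomorphism of monoids. -/
noncomputable def ratLift {A : Type*} [Ring A] [Algebra ℂ A] (f : Γ →* A) :
    MonoidAlgebra ℚ Γ →+* A :=
  MonoidAlgebra.liftNCRingHom ((algebraMap ℂ A).comp (algebraMap ℚ ℂ)) f
    fun q γ => Algebra.commutes (q : ℂ) (f γ)

theorem ratLift_single {A : Type*} [Ring A] [Algebra ℂ A] (f : Γ →* A) (γ : Γ) (q : ℚ) :
    ratLift f (MonoidAlgebra.single γ q) = (q : ℂ) • f γ := by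
  rw [Algebra.smul_def]
  exact MonoidAlgebra.liftNC_single _ _ _ _

/-- The image of the rational group algebra in the maximal group C*-algebra. -/
noncomputable def MaxGroupCStar.ofRat (Γ : Type u) [Group Γ] :
    MonoidAlgebra ℚ Γ →+* MaxGroupCStar Γ :=
  ratLift (MaxGroupCStar.of Γ)

theorem MaxGroupCStar.ofRat_single (γ : Γ) (q : ℚ) :
    MaxGroupCStar.ofRat Γ (MonoidAlgebra.single γ q) = (q : ℂ) • MaxGroupCStar.of Γ γ :=
  ratLift_single _ γ q

theorem MaxGroupCStar.star_of (γ : Γ) :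
    star (MaxGroupCStar.of Γ γ) = MaxGroupCStar.of Γ γ⁻¹ := by
  change star ((MonoidAlgebra.of ℂ Γ γ : MonoidAlgebra ℂ Γ) : MaxGroupCStar Γ) =
    ((MonoidAlgebra.of ℂ Γ γ⁻¹ : MonoidAlgebra ℂ Γ) : MaxGroupCStar Γ)
  rw [maxGroupCStar_star_coe]
  simp [groupAlgebra_star_single]

theorem leftAct_leftMul (a : MonoidAlgebra ℚ Γ) (x : MaxGroupCStar Γ) :
    leftAct (MaxGroupCStar.leftMul Γ) a x = MaxGroupCStar.ofRat Γ a * x := by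
  induction a using MonoidAlgebra.induction_linear with
  | zero => simp [leftAct]
  | add a b ha hb =>
    rw [map_add, add_mul, ← ha, ← hb, ← LinearMap.add_apply]
    congr 1
    exact Finsupp.sum_add_index' (by simp) (by simp [add_smul])
  | single γ q =>
    rw [MaxGroupCStar.ofRat_single]
    simp [leftAct, MonoidAlgebra.coeff_single, MaxGroupCStar.leftMul_apply]

/-- Rational coefficients are self-conjugate and `γ* = γ⁻¹`, so the right action is left
multiplication by the adjoint. Boundary maps thus have the adjoints of the resolution's entries as
coefficients. -/
theorem rightAct_leftMul (a : MonoidAlgebra ℚ Γ) (x : MaxGroupCStar Γ) :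
    rightAct (MaxGroupCStar.leftMul Γ) a x = star (MaxGroupCStar.ofRat Γ a) * x := by
  induction a using MonoidAlgebra.induction_linear with
  | zero => simp [rightAct]
  | add a b ha hb =>
    rw [map_add, star_add, add_mul, ← ha, ← hb, ← LinearMap.add_apply]
    congr 1
    exact Finsupp.sum_add_index' (by simp) (by simp [add_smul])
  | single γ q =>
    rw [MaxGroupCStar.ofRat_single]
    simp [rightAct, MonoidAlgebra.coeff_single, MaxGroupCStar.leftMul_apply, star_smul,
      MaxGroupCStar.star_of]

/-! ### The augmentation ideal and Kazhdan pairs -/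

/-- The element `γ - 1` of the rational group algebra. -/
noncomputable def subOne (γ : Γ) : MonoidAlgebra ℚ Γ := MonoidAlgebra.of ℚ Γ γ - 1

theorem MaxGroupCStar.ofRat_subOne (γ : Γ) :
    MaxGroupCStar.ofRat Γ (subOne γ) = MaxGroupCStar.of Γ γ - 1 := by
  rw [subOne, map_sub, map_one, MonoidAlgebra.of_apply, MaxGroupCStar.ofRat_single]
  simp

theorem UnitaryRep.toStarAlgHom_ofRat_subOne {H : Type u} [NormedAddCommGroup H]
    [InnerProductSpace ℂ H] [CompleteSpace H] (π : UnitaryRep Γ H) (γ : Γ) (v : H) :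
    π.toStarAlgHom (MaxGroupCStar.ofRat Γ (subOne γ)) v = (π γ : H →L[ℂ] H) v - v := by
  rw [MaxGroupCStar.ofRat_subOne, map_sub, map_one, π.toStarAlgHom_of]
  simp

/-- The left ideal of the rational group algebra that is generated by the elements `s - 1`. -/
noncomputable def subOneIdeal (S : Set Γ) : Submodule (MonoidAlgebra ℚ Γ) (MonoidAlgebra ℚ Γ) :=
  Submodule.span _ (subOne '' S)

theorem subOneIdeal_mono {S T : Set Γ} (h : S ⊆ T) : subOneIdeal S ≤ subOneIdeal T :=
  Submodule.span_mono (Set.image_mono h)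

theorem exists_finset_mem_subOneIdeal {x : MonoidAlgebra ℚ Γ}
    (hx : x ∈ subOneIdeal (Set.univ : Set Γ)) : ∃ S : Finset Γ, x ∈ subOneIdeal (S : Set Γ) := by
  classical
  obtain ⟨T, hT, hxT⟩ := Submodule.mem_span_finite_of_mem_span hx
  rw [Finset.subset_set_image_iff] at hT
  obtain ⟨S, -, rfl⟩ := hT
  exact ⟨S, by simpa [subOneIdeal] using hxT⟩

theorem mem_subOneIdeal_induction {S : Finset Γ} {p : MonoidAlgebra ℚ Γ → Prop}
    (zero : p 0) (add : ∀ x y, p x → p y → p (x + y))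
    (mul : ∀ a, ∀ s ∈ S, p (a * subOne s)) {x : MonoidAlgebra ℚ Γ}
    (hx : x ∈ subOneIdeal (S : Set Γ)) : p x := by
  induction hx using Submodule.closure_induction with
  | zero => exact zero
  | add x y _ _ hx hy => exact add x y hx hy
  | smul_mem a x hx =>
    obtain ⟨s, hs, rfl⟩ := hx
    exact mul a s hs

/-- If all `γ - 1` lie in the left ideal generated by `s - 1`, `s ∈ S`, then a bounded
factorization for the elements `s - 1` of `C*Γ` makes `S` part of a Kazhdan pair. -/
theorem hasPropertyT_of_hasBoundedSupportFactorization {S : Finset Γ}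
    (hS : ∀ γ : Γ, subOne γ ∈ subOneIdeal (S : Set Γ))
    (h : HasBoundedSupportFactorization fun s : S =>
      MaxGroupCStar.ofRat Γ (subOne (s : Γ))) : HasPropertyT Γ := by
  obtain ⟨C, hC⟩ := h.exists_norm_le.{_, u}
  -- With this `ε` the estimate would give `‖v‖ ≤ |C||S| / (|C||S| + 1) · ‖v‖`, impossible for `v ≠
  -- 0`.
  refine ⟨S, (|C| * S.card + 1)⁻¹, by positivity, ?_⟩
  rintro H _ _ _ π ⟨v, hv, hvS⟩
  by_contra! hinv
  have h1 := hC H π.toStarAlgHom (fun w hw => by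
    by_contra hw0
    obtain ⟨γ, hγ⟩ := hinv w hw0
    apply hγ
    have hz : π.toStarAlgHom (MaxGroupCStar.ofRat Γ (subOne γ)) w = 0 :=
      mem_subOneIdeal_induction
        (p := fun x => π.toStarAlgHom (MaxGroupCStar.ofRat Γ x) w = 0) (by simp)
        (fun x y hx hy => by simp [hx, hy])
        (fun a s hs => by simp [hw ⟨s, hs⟩]) (hS γ)
    rwa [π.toStarAlgHom_ofRat_subOne, sub_eq_zero] at hz) v
  simp only [π.toStarAlgHom_ofRat_subOne] at h1
  have hvpos : 0 < ‖v‖ := norm_pos_iff.2 hv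
  have h2 : ∑ s : S, ‖(π s : H →L[ℂ] H) v - v‖ ≤ S.card * ((|C| * S.card + 1)⁻¹ * ‖v‖) := by
    calc ∑ s : S, ‖(π s : H →L[ℂ] H) v - v‖
        ≤ ∑ _s : S, (|C| * S.card + 1)⁻¹ * ‖v‖ := Finset.sum_le_sum fun s _ => (hvS s s.2).le
      _ = _ := by simp
  have h3 : ‖v‖ ≤ |C| * (S.card * ((|C| * S.card + 1)⁻¹ * ‖v‖)) :=
    h1.trans ((mul_le_mul_of_nonneg_right (le_abs_self C)
      (Finset.sum_nonneg fun _ _ => norm_nonneg _)).trans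
      (mul_le_mul_of_nonneg_left h2 (abs_nonneg C)))
  have h4 : |C| * (S.card * ((|C| * S.card + 1)⁻¹ * ‖v‖)) =
      (|C| * S.card) / (|C| * S.card + 1) * ‖v‖ := by ring
  have h5 : (|C| * S.card) / (|C| * S.card + 1) < 1 := by
    rw [div_lt_one (by positivity)]
    linarith
  rw [h4] at h3
  nlinarith

end Group

/-- The preimage of the closed point 0 is `q` inside `p`, and a closed subset of the closed `p` is
closed in `E`. -/
theorem Submodule.isClosed_of_t2Space_quotient_submoduleOf {𝕜 E : Type*} [Ring 𝕜]
    [AddCommGroup E] [Module 𝕜 E] [TopologicalSpace E] {p q : Submodule 𝕜 E} (hqp : q ≤ p)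
    (hp : IsClosed (p : Set E)) (h : T2Space (p ⧸ q.submoduleOf p)) : IsClosed (q : Set E) := by
  have h0 : IsClosed ({0} : Set (p ⧸ q.submoduleOf p)) := isClosed_singleton
  have h1 : IsClosed {x : p | (Submodule.Quotient.mk x : p ⧸ q.submoduleOf p) = 0} :=
    h0.preimage continuous_quot_mk
  have h2 := hp.isClosedEmbedding_subtypeVal.isClosedMap _ h1
  convert h2 using 1
  ext x
  simp only [Submodule.Quotient.mk_eq_zero]
  exact ⟨fun hx => ⟨⟨x, hqp hx⟩, hx, rfl⟩, by rintro ⟨y, hy, rfl⟩; exact hy⟩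

section Group

variable {Γ : Type u} [Group Γ]

/-- Expand `x` as a sum of terms `a (s - 1)`; adding up the norms `‖f a‖` gives a `K` independent of
`b`. -/
theorem exists_norm_map_mul_le {A : Type*} [NormedRing A] (f : MonoidAlgebra ℚ Γ →+* A)
    {S : Finset Γ} {x : MonoidAlgebra ℚ Γ} (hx : x ∈ subOneIdeal (S : Set Γ)) :
    ∃ K : ℝ, 0 ≤ K ∧ ∀ b : A, ‖f x * b‖ ≤ K * ∑ s : S, ‖f (subOne (s : Γ)) * b‖ := by
  refine mem_subOneIdeal_induction (p := fun x => ∃ K : ℝ, 0 ≤ K ∧ ∀ b : A,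
    ‖f x * b‖ ≤ K * ∑ s : S, ‖f (subOne (s : Γ)) * b‖) ?_ ?_ ?_ hx
  · exact ⟨0, le_rfl, fun b => by simp⟩
  · rintro x y ⟨K, hK, h⟩ ⟨L, hL, h'⟩
    refine ⟨K + L, add_nonneg hK hL, fun b => ?_⟩
    rw [map_add, add_mul, add_mul]
    exact (norm_add_le _ _).trans (add_le_add (h b) (h' b))
  · intro a s hs
    refine ⟨‖f a‖, norm_nonneg _, fun b => ?_⟩
    rw [map_mul, mul_assoc]
    refine (norm_mul_le _ _).trans (mul_le_mul_of_nonneg_left ?_ (norm_nonneg _))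
    have h := Finset.single_le_sum (s := Finset.univ) (a := (⟨s, hs⟩ : S))
      (f := fun t : S => ‖f (subOne (t : Γ)) * b‖) (fun _ _ => norm_nonneg _) (Finset.mem_univ _)
    exact h

/-- The right ideal that is generated by the adjoints of the images of `s - 1`, `s ∈ S`. -/
noncomputable def starSubOneIdeal {A : Type*} [Ring A] [StarRing A] (f : MonoidAlgebra ℚ Γ →+* A)
    (S : Finset Γ) : AddSubgroup A :=
  AddMonoidHom.range (AddMonoidHom.mk' (fun x : S → A =>
    ∑ s : S, star (f (subOne (s : Γ))) * x s)
    fun x y => by simp [mul_add, Finset.sum_add_distrib])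

theorem star_map_mul_mem_starSubOneIdeal {A : Type*} [Ring A] [StarRing A]
    (f : MonoidAlgebra ℚ Γ →+* A) {S : Finset Γ} {x : MonoidAlgebra ℚ Γ}
    (hx : x ∈ subOneIdeal (S : Set Γ)) (b : A) : star (f x) * b ∈ starSubOneIdeal f S := by
  classical
  refine mem_subOneIdeal_induction
    (p := fun x => star (f x) * b ∈ starSubOneIdeal f S) ?_ ?_ ?_ hx
  · simp
  · intro x y hx hy
    rw [map_add, star_add, add_mul]
    exact add_mem hx hy
  · intro a s hs
    refine AddMonoidHom.mem_range.2 ⟨Pi.single ⟨s, hs⟩ (star (f a) * b), ?_⟩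
    rw [map_mul, star_mul, mul_assoc]
    change ∑ t : S, _ = _
    rw [Finset.sum_eq_single (⟨s, hs⟩ : S)]
    · simp
    · intro t _ ht
      simp [Pi.single_eq_of_ne ht]
    · simp

/-! ### Comparing a resolution with the generators of the augmentation ideal -/

namespace BasedResolution

variable (R : BasedResolution.{u, v} Γ)

theorem repr_d (n : ℕ) (w : R.P (n + 1)) (j : Fin (R.rank n)) :
    (R.basis n).repr (R.d n w) j = ∑ i, (R.basis (n + 1)).repr w i * R.entry n i j := by
  conv_lhs => rw [← (R.basis (n + 1)).sum_repr w]
  rw [map_sum, map_sum, Finsupp.finsetSum_apply]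
  refine Finset.sum_congr rfl fun i _ => ?_
  rw [map_smul, map_smul, Finsupp.smul_apply]
  rfl

theorem boundary_leftMul_apply (n : ℕ) (x : Fin (R.rank (n + 1)) → MaxGroupCStar Γ)
    (j : Fin (R.rank n)) : R.boundary (MaxGroupCStar.leftMul Γ) n x j =
      ∑ i, star (MaxGroupCStar.ofRat Γ (R.entry n i j)) * x i := by
  simp [boundary, rightAct_leftMul]

theorem coboundary_leftMul_apply (n : ℕ) (y : Fin (R.rank n) → MaxGroupCStar Γ)
    (i : Fin (R.rank (n + 1))) : R.coboundary (MaxGroupCStar.leftMul Γ) n y i =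
      ∑ j, MaxGroupCStar.ofRat Γ (R.entry n i j) * y j := by
  simp [coboundary, leftAct_leftMul]

theorem continuous_coboundary_leftMul (n : ℕ) :
    Continuous (R.coboundary (MaxGroupCStar.leftMul Γ) n) := by
  refine continuous_pi fun i => ?_
  simp only [coboundary_leftMul_apply]
  fun_prop

theorem isClosed_cocycles_leftMul (n : ℕ) :
    IsClosed (R.cocycles (MaxGroupCStar.leftMul Γ) n :
      Set (Fin (R.rank n) → MaxGroupCStar Γ)) :=
  isClosed_singleton.preimage (R.continuous_coboundary_leftMul n)

theorem coboundaries_leftMul_le_cocycles (n : ℕ) :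
    R.coboundaries (MaxGroupCStar.leftMul Γ) (n + 1) ≤
      R.cocycles (MaxGroupCStar.leftMul Γ) (n + 1) := by
  rintro _ ⟨y, rfl⟩
  refine LinearMap.mem_ker.2 (funext fun i => ?_)
  simp only [coboundary_leftMul_apply, Finset.mul_sum, ← mul_assoc, ← map_mul]
  rw [Finset.sum_comm]
  simp only [← Finset.sum_mul, ← map_sum]
  refine Finset.sum_eq_zero fun k _ => ?_
  have h := R.repr_d n (R.d (n + 1) (R.basis (n + 2) i)) k
  rw [(R.exact_succ n).apply_apply_eq_zero] at h
  have h2 : ∑ j, R.entry (n + 1) i j * R.entry n j k = 0 := by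
    simpa [entry] using h.symm
  rw [h2, map_zero, zero_mul]

/-- The `ℚΓ`-linear map `P 0 → ℚΓ` that agrees with the augmentation on the basis. -/
noncomputable def augLift : R.P 0 →ₗ[MonoidAlgebra ℚ Γ] MonoidAlgebra ℚ Γ :=
  (R.basis 0).constr ℕ fun j => algebraMap ℚ (MonoidAlgebra ℚ Γ) (R.aug (R.basis 0 j))

theorem augLift_apply (z : R.P 0) : R.augLift z =
    ∑ j, (R.basis 0).repr z j * algebraMap ℚ (MonoidAlgebra ℚ Γ) (R.aug (R.basis 0 j)) := by
  simp [augLift, Module.Basis.constr_apply_fintype]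

theorem augLift_sub_aug_mem (z : R.P 0) :
    R.augLift z - algebraMap ℚ (MonoidAlgebra ℚ Γ) (R.aug z) ∈
      subOneIdeal (Set.univ : Set Γ) := by
  have hz : z ∈ Submodule.span (MonoidAlgebra ℚ Γ) (Set.range (R.basis 0)) :=
    (R.basis 0).mem_span z
  induction hz using Submodule.span_induction with
  | mem x hx =>
    obtain ⟨j, rfl⟩ := hx
    simp [augLift]
  | zero => simp
  | add x y _ _ hx hy =>
    rw [map_add, map_add, map_add, add_sub_add_comm]
    exact add_mem hx hy
  | smul a x _ hx =>
    induction a using MonoidAlgebra.induction_linear with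
    | zero => simp
    | add a b ha hb =>
      rw [add_smul, map_add, map_add, map_add, add_sub_add_comm]
      exact add_mem ha hb
    | single γ q =>
      -- `augLift` is `ℚΓ`-linear, whereas the augmentation, read in `ℚΓ`, is so only modulo the
      -- augmentation ideal; the last summand is that error.
      have h : R.augLift (MonoidAlgebra.single γ q • x) -
          algebraMap ℚ (MonoidAlgebra ℚ Γ) (R.aug (MonoidAlgebra.single γ q • x)) =
          MonoidAlgebra.single γ q • (R.augLift x - algebraMap ℚ _ (R.aug x)) +
            algebraMap ℚ (MonoidAlgebra ℚ Γ) (R.aug x * q) • subOne γ := by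
        rw [R.aug_smul, map_smul, smul_sub, subOne, smul_sub]
        simp [MonoidAlgebra.single_mul_single, mul_comm]
      rw [h]
      exact add_mem (Submodule.smul_mem _ _ hx)
        (Submodule.smul_mem _ _ (Submodule.subset_span ⟨γ, trivial, rfl⟩))

theorem exists_d_eq_subOne_smul (p : R.P 0) (γ : Γ) : ∃ w, R.d 0 w = subOne γ • p := by
  refine (R.exact_zero _).1 ?_
  rw [subOne, sub_smul, one_smul, map_sub, MonoidAlgebra.of_apply, R.aug_smul, one_mul, sub_self]

theorem augLift_d (w : R.P 1) : R.augLift (R.d 0 w) =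
    ∑ i, (R.basis 1).repr w i • R.augLift (R.d 0 (R.basis 1 i)) := by
  conv_lhs => rw [← (R.basis 1).sum_repr w]
  simp only [map_sum, map_smul]

/-- The element `augLift p - 1` and the finitely many `augLift (d e_i)`, with `e_i` the basis of `P
1`, lie in the augmentation ideal, so a finite `S` accounts for all of them. Conversely they
generate every `γ - 1`, because `(γ - 1) p` is a boundary. -/
theorem exists_augLift_mem (R : BasedResolution.{u, v} Γ) : ∃ (S : Finset Γ) (p : R.P 0),
    R.augLift p - 1 ∈ subOneIdeal (S : Set Γ) ∧
    (∀ i, R.augLift (R.d 0 (R.basis 1 i)) ∈ subOneIdeal (S : Set Γ)) ∧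
    ∀ γ : Γ, subOne γ ∈ subOneIdeal (S : Set Γ) := by
  classical
  obtain ⟨p, hp⟩ := R.aug_surjective 1
  have h1 := R.augLift_sub_aug_mem p
  rw [hp, map_one] at h1
  obtain ⟨S₀, hS₀⟩ := exists_finset_mem_subOneIdeal h1
  have h2 : ∀ i, ∃ S : Finset Γ,
      R.augLift (R.d 0 (R.basis 1 i)) ∈ subOneIdeal (S : Set Γ) := fun i => by
    have h := R.augLift_sub_aug_mem (R.d 0 (R.basis 1 i))
    rw [R.exact_zero.apply_apply_eq_zero, map_zero, sub_zero] at h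
    exact exists_finset_mem_subOneIdeal h
  choose T hT using h2
  set S := S₀ ∪ Finset.univ.biUnion T with hS
  have h0 : R.augLift p - 1 ∈ subOneIdeal (S : Set Γ) :=
    subOneIdeal_mono (Finset.coe_subset.2 Finset.subset_union_left) hS₀
  have h3 : ∀ i, R.augLift (R.d 0 (R.basis 1 i)) ∈ subOneIdeal (S : Set Γ) := fun i =>
    subOneIdeal_mono (Finset.coe_subset.2
      ((Finset.subset_biUnion_of_mem T (Finset.mem_univ i)).trans Finset.subset_union_right)) (hT i)
  refine ⟨S, p, h0, h3, fun γ => ?_⟩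
  obtain ⟨w, hw⟩ := R.exists_d_eq_subOne_smul p γ
  have h4 : subOne γ = R.augLift (R.d 0 w) - subOne γ • (R.augLift p - 1) := by
    rw [hw, map_smul, smul_sub]
    simp
  rw [h4, augLift_d]
  exact sub_mem (sum_mem fun i _ => Submodule.smul_mem _ _ (h3 i)) (Submodule.smul_mem _ _ h0)

/-- The right ideal `∑ d_s* A` is the preimage of the closed space of boundaries under the
continuous map `θ : a ↦ a ⊗ p`. -/
theorem hasPropertyT_of_t2Space_homology
    (h : T2Space (R.Homology (MaxGroupCStar.leftMul Γ) 0)) : HasPropertyT Γ := by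
  have hB : IsClosed (R.boundaries (MaxGroupCStar.leftMul Γ) 0 :
      Set (Fin (R.rank 0) → MaxGroupCStar Γ)) :=
    Submodule.isClosed_of_t2Space_quotient_submoduleOf le_top isClosed_univ h
  obtain ⟨S, p, hp, hd, hS⟩ := R.exists_augLift_mem
  refine hasPropertyT_of_hasBoundedSupportFactorization hS
    (hasBoundedSupportFactorization_of_isClosed_range _ ?_)
  change IsClosed (starSubOneIdeal (MaxGroupCStar.ofRat Γ) S : Set (MaxGroupCStar Γ))
  let θ : MaxGroupCStar Γ → Fin (R.rank 0) → MaxGroupCStar Γ := fun a j =>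
    star (MaxGroupCStar.ofRat Γ ((R.basis 0).repr p j)) * a
  have hθ : Continuous θ := by fun_prop
  convert hB.preimage hθ using 1
  ext a
  constructor
  · rintro ⟨x, rfl⟩
    have hsum : θ (∑ s : S, star (MaxGroupCStar.ofRat Γ (subOne (s : Γ))) * x s) =
        ∑ s : S, θ (star (MaxGroupCStar.ofRat Γ (subOne (s : Γ))) * x s) := by
      ext j
      simp [θ, Finset.mul_sum]
    change θ (∑ s : S, _) ∈ R.boundaries _ 0
    rw [hsum]
    refine sum_mem fun s _ => ?_
    obtain ⟨w, hw⟩ := R.exists_d_eq_subOne_smul p (s : Γ)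
    refine ⟨fun i => star (MaxGroupCStar.ofRat Γ ((R.basis 1).repr w i)) * x s, ?_⟩
    ext j
    have h1 := R.repr_d 0 w j
    rw [hw, map_smul, Finsupp.smul_apply, smul_eq_mul] at h1
    simp only [boundary_leftMul_apply, θ, ← mul_assoc, ← star_mul, ← map_mul]
    rw [h1, map_sum, star_sum, Finset.sum_mul]
  · rintro ⟨x, hx⟩
    have h1 : star (MaxGroupCStar.ofRat Γ (R.augLift p)) * a =
        ∑ i, star (MaxGroupCStar.ofRat Γ (R.augLift (R.d 0 (R.basis 1 i)))) * x i := by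
      calc star (MaxGroupCStar.ofRat Γ (R.augLift p)) * a
          = ∑ j, star (MaxGroupCStar.ofRat Γ
              (algebraMap ℚ (MonoidAlgebra ℚ Γ) (R.aug (R.basis 0 j)))) * θ a j := by
            rw [augLift_apply, map_sum, star_sum, Finset.sum_mul]
            simp only [θ, map_mul, star_mul, mul_assoc]
        _ = _ := by
            rw [← hx]
            simp only [boundary_leftMul_apply, Finset.mul_sum]
            rw [Finset.sum_comm]
            refine Finset.sum_congr rfl fun i _ => ?_
            rw [augLift_apply, map_sum, star_sum, Finset.sum_mul]
            simp only [entry, map_mul, star_mul, mul_assoc]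
    -- Applying `augLift` to `a ⊗ p` recovers `a` up to the term from `augLift p - 1`, which lies in
    -- the ideal as well.
    have h2 : a = ∑ i, star (MaxGroupCStar.ofRat Γ (R.augLift (R.d 0 (R.basis 1 i)))) * x i -
        star (MaxGroupCStar.ofRat Γ (R.augLift p - 1)) * a := by
      rw [← h1, map_sub, star_sub, sub_mul, map_one, star_one, one_mul, sub_sub_cancel]
    rw [h2]
    exact sub_mem (sum_mem fun i _ => star_map_mul_mem_starSubOneIdeal _ (hd i) _)
      (star_map_mul_mem_starSubOneIdeal _ hp a)

/-- Pull `b` back along `augLift` to a 0-cochain `y`, whose coboundary is controlled by `∑ ‖d_s b‖`.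
Closed range gives a small `y'` with the same coboundary. The 0-cocycle `y - y'`, evaluated at `p`,
is the invariant element `ξ` to subtract from `b`. -/
theorem hasPropertyT_of_t2Space_cohomology
    (h : T2Space (R.Cohomology (MaxGroupCStar.leftMul Γ) 1)) : HasPropertyT Γ := by
  have hB : IsClosed (R.coboundaries (MaxGroupCStar.leftMul Γ) 1 :
      Set (Fin (R.rank 1) → MaxGroupCStar Γ)) :=
    Submodule.isClosed_of_t2Space_quotient_submoduleOf (R.coboundaries_leftMul_le_cocycles 0)
      (R.isClosed_cocycles_leftMul 1) h
  obtain ⟨S, p, hp, hd, hS⟩ := R.exists_augLift_mem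
  let N : (Fin (R.rank 0) → MaxGroupCStar Γ) →L[ℂ] (Fin (R.rank 1) → MaxGroupCStar Γ) :=
    ⟨R.coboundary (MaxGroupCStar.leftMul Γ) 0, R.continuous_coboundary_leftMul 0⟩
  have hN : ∀ y i, N y i = ∑ j, MaxGroupCStar.ofRat Γ (R.entry 0 i j) * y j :=
    R.coboundary_leftMul_apply 0
  obtain ⟨C, hC, hpre⟩ := N.exists_preimage_norm_le_of_isClosed_range hB
  obtain ⟨K, hK, hpK⟩ := exists_norm_map_mul_le (MaxGroupCStar.ofRat Γ) hp
  choose L hL hdL using fun i =>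
    exists_norm_map_mul_le (MaxGroupCStar.ofRat Γ) (hd i)
  set M := ∑ j, ‖MaxGroupCStar.ofRat Γ ((R.basis 0).repr p j)‖ with hM
  have hM0 : 0 ≤ M := Finset.sum_nonneg fun _ _ => norm_nonneg _
  have hL0 : 0 ≤ ∑ i, L i := Finset.sum_nonneg fun i _ => hL i
  refine hasPropertyT_of_hasBoundedSupportFactorization hS
    (hasBoundedSupportFactorization_of_bounded_correction _
      (C := K + M * (C * ∑ i, L i)) (by positivity) fun b => ?_)
  set D := ∑ s : S, ‖MaxGroupCStar.ofRat Γ (subOne (s : Γ)) * b‖ with hD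
  have hD0 : 0 ≤ D := Finset.sum_nonneg fun _ _ => norm_nonneg _
  let y : Fin (R.rank 0) → MaxGroupCStar Γ := fun j => MaxGroupCStar.ofRat Γ
    (algebraMap ℚ (MonoidAlgebra ℚ Γ) (R.aug (R.basis 0 j))) * b
  have hNy : ∀ i, N y i = MaxGroupCStar.ofRat Γ (R.augLift (R.d 0 (R.basis 1 i))) * b := by
    intro i
    rw [hN, augLift_apply, map_sum, Finset.sum_mul]
    simp only [y, entry, map_mul, mul_assoc]
  have hNyn : ‖N y‖ ≤ (∑ i, L i) * D := by
    refine (pi_norm_le_iff_of_nonneg (by positivity)).2 fun i => ?_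
    rw [hNy]
    exact (hdL i b).trans (mul_le_mul_of_nonneg_right
      (Finset.single_le_sum (fun i _ => hL i) (Finset.mem_univ i)) hD0)
  obtain ⟨y', hy', hn⟩ := hpre y
  let ξ := ∑ j, MaxGroupCStar.ofRat Γ ((R.basis 0).repr p j) * (y j - y' j)
  have hξ : ∀ s : Γ, MaxGroupCStar.ofRat Γ (subOne s) * ξ = 0 := by
    intro s
    obtain ⟨w, hw⟩ := R.exists_d_eq_subOne_smul p s
    have h0 : ∀ i, ∑ j, MaxGroupCStar.ofRat Γ (R.entry 0 i j) * (y j - y' j) = 0 := by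
      intro i
      simp only [mul_sub, Finset.sum_sub_distrib]
      rw [← hN, ← hN, hy', sub_self]
    calc MaxGroupCStar.ofRat Γ (subOne s) * ξ
        = ∑ j, MaxGroupCStar.ofRat Γ ((R.basis 0).repr (R.d 0 w) j) * (y j - y' j) := by
          simp only [ξ, Finset.mul_sum, ← mul_assoc, ← map_mul]
          refine Finset.sum_congr rfl fun j _ => ?_
          rw [hw, map_smul, Finsupp.smul_apply, smul_eq_mul]
      _ = ∑ i, MaxGroupCStar.ofRat Γ ((R.basis 1).repr w i) *
            ∑ j, MaxGroupCStar.ofRat Γ (R.entry 0 i j) * (y j - y' j) := by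
          simp only [repr_d, map_sum, map_mul, Finset.sum_mul, Finset.mul_sum, mul_assoc]
          exact Finset.sum_comm
      _ = 0 := by simp [h0]
  refine ⟨b - ξ, fun s => by rw [mul_sub, hξ, sub_zero], ?_⟩
  -- Evaluating `y` at `p` gives `augLift p · b` rather than `b`. The first term is this
  -- discrepancy, bounded by `K D`; the second is `y'` at `p`, bounded through `C` and `M`.
  have hbξ : b - ξ = -(MaxGroupCStar.ofRat Γ (R.augLift p - 1) * b) +
      ∑ j, MaxGroupCStar.ofRat Γ ((R.basis 0).repr p j) * y' j := by
    have h1 : MaxGroupCStar.ofRat Γ (R.augLift p) * b =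
        ∑ j, MaxGroupCStar.ofRat Γ ((R.basis 0).repr p j) * y j := by
      rw [augLift_apply, map_sum, Finset.sum_mul]
      simp only [y, map_mul, mul_assoc]
    simp only [ξ, mul_sub, Finset.sum_sub_distrib]
    rw [← h1, map_sub, map_one, sub_mul, one_mul]
    abel
  have hy'n : ‖∑ j, MaxGroupCStar.ofRat Γ ((R.basis 0).repr p j) * y' j‖ ≤
      M * (C * ((∑ i, L i) * D)) := by
    rw [hM, Finset.sum_mul]
    refine (norm_sum_le _ _).trans (Finset.sum_le_sum fun j _ => (norm_mul_le _ _).trans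
      (mul_le_mul_of_nonneg_left ?_ (norm_nonneg _)))
    exact (norm_le_pi_norm y' j).trans (hn.trans (mul_le_mul_of_nonneg_left hNyn hC.le))
  calc ‖b - ξ‖ ≤ K * D + M * (C * ((∑ i, L i) * D)) := by
        rw [hbξ]
        refine (norm_add_le _ _).trans (add_le_add ?_ hy'n)
        rw [norm_neg]
        exact hpK b
    _ = (K + M * (C * ∑ i, L i)) * D := by ring

end BasedResolution

end Group

theorem lemma2 {Γ : Type u} [Group Γ] (R : BasedResolution.{u, v} Γ) (hT : ¬ HasPropertyT Γ) :
    ¬ T2Space (R.Homology (MaxGroupCStar.leftMul Γ) 0) ∧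
      ¬ T2Space (R.Cohomology (MaxGroupCStar.leftMul Γ) 1) :=
  ⟨fun h => hT (R.hasPropertyT_of_t2Space_homology h),
    fun h => hT (R.hasPropertyT_of_t2Space_cohomology h)⟩
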